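/- Let $n \ge 1$ and $d \ge 0$ be integers. Let $\mathbf X \in \mathbb{R}^{n\times d}$ be a covariate matrix with rows $\mathbf x_1,\dots,\mathbf x_n$ (the covariate vectors of $n$ units), let $\xi = \max_{i} \|\mathbf x_i\|$ (Euclidean norm), and let $\phi \in (0,1)$. Let $$\mathbf B = \begin{bmatrix} \sqrt{\phi}\,\mathbf I_n \\ \xi^{-1}\sqrt{1-\phi}\,\mathbf X^{\mathsf T}\end{bmatrix} \in \mathbb{R}^{(n+d)\times n}$$ (if $\xi = 0$, the lower block is zero). The Gram–Schmidt Walk design is the distribution of the random vector $\mathbf z \in \{\pm1\}^n$ produced by the following algorithm. Start with $\mathbf z_1 = \mathbf 0$. In iteration $t$, call unit $i$ alive if $|z_{t,i}| < 1$, and stop with $\mathbf z = \mathbf z_t$ if no unit is alive. Otherwise, keep the pivot unit $p$ of the previous iteration if it exists and is alive, and if not draw a new pivot $p$ uniformly at random from the alive units. Let $\mathbf u_t$ minimize $\|\mathbf B \mathbf u\|$ over all $\mathbf u \in \mathbb{R}^n$ with $u_p = 1$ and $u_i = 0$ for all $i$ not alive. Let $\Delta = \{\delta \in \mathbb{R}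 : \mathbf z_t + \delta \mathbf u_t \in [-1,1]^n\}$, $\delta^+ = |\max \Delta|$ and $\delta^- = |\min\Delta|$. Set $\mathbf z_{t+1} = \mathbf z_t + \delta_t \mathbf u_t$, where, with fresh randomness, $\delta_t = \delta^+$ with probability $\delta^- /(\delta^++\delta^-)$ and $\delta_t = -\delta^-$ with probability $\delta^+/(\delta^++\delta^-)$. (The algorithm stops after at most $n$ iterations.) Let $\mathbf a, \mathbf b \in \mathbb{R}^n$ be arbitrary vectors of potential outcomes under the treatments $+1$ and $-1$, so that the observed outcome of unit $i$ is $y_i = a_i$ if $z_i = 1$ and $y_i = b_i$ if $z_i = -1$. Let $\tau = \frac1n\sum_{i=1}^n (a_i - b_i)$ be the average treatment effect, let $$\widehat\tau = \frac1n\Bigl[\sum_{i : z_i = 1} \frac{y_i}{\Pr(z_i = 1)} - \sum_{i : z_i = -1} \frac{y_i}{\Pr(z_i=-1)}\Bigr]$$ be the Horvitz–Thompson estimator, and let $\boldsymbol\mu = (\mathbf a + \mathbf b)/2$. Theorem. Under the Gram–Schmidt Walk design, $$\mathbb{E}\bigl[(\widehat\tau - \tau)^2\bigr] \le \frac{4L}{n^2},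 \qquad L = \min_{\boldsymbol\beta\in\mathbb{R}^d}\Bigl[\frac1\phi\,\|\boldsymbol\mu - \mathbf X\boldsymbol\beta\|^2 + \frac{\xi^2}{1-\phi}\,\|\boldsymbol\beta\|^2\Bigr],$$ where the minimum is attained. -/

import Mathlib

open MeasureTheory

noncomputable section

namespace GramSchmidtWalk

variable {n d : ℕ}

/-- The Euclidean norm of a vector given by its coordinates. -/
def eNorm {ι : Type*} [Fintype ι] (v : ι → ℝ) : ℝ := ‖WithLp.toLp 2 v‖

/-- `ξ`: the largest Euclidean norm of a covariate vector, where row `i` of the covariate matrix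
`X` is the covariate vector of unit `i`. -/
def maxRowNorm (X : Matrix (Fin n) (Fin d) ℝ) : ℝ := ⨆ i, eNorm (X i)

/-- The `(n + d) × n` augmented covariate matrix: `√φ I` stacked on top of
`ξ⁻¹ √(1 - φ) Xᵀ`. -/
def augmented (X : Matrix (Fin n) (Fin d) ℝ) (φ : ℝ) : Matrix (Fin n ⊕ Fin d) (Fin n) ℝ :=
  Matrix.fromRows (√φ • (1 : Matrix (Fin n) (Fin n) ℝ))
    (((maxRowNorm X)⁻¹ * √(1 - φ)) • X.transpose)

/-- The units whose fractional assignment is not yet integral. -/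
def alive (z : Fin n → ℝ) : Finset (Fin n) := Finset.univ.filter fun i => |z i| < 1

/-- `u` is admissible as a step direction when `A` is the set of alive units and `p` is the
pivot: the pivot has coordinate one and the units that are not alive have coordinate zero. -/
def IsAdmissible (A : Finset (Fin n)) (p : Fin n) (u : Fin n → ℝ) : Prop :=
  u p = 1 ∧ ∀ i, i ∉ A → u i = 0

theorem exists_stepDirection {κ : Type*} [Fintype κ] (B : Matrix κ (Fin n) ℝ)
    {A : Finset (Fin n)} {p : Fin n} (hp : p ∈ A) :
    ∃ u, IsAdmissible A p u ∧ ∀ v, IsAdmissible A p v → eNorm (B.mulVec u) ≤ eNorm (B.mulVec v) := by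
  classical
  let V : Submodule ℝ (Fin n → ℝ) :=
    { carrier := {v | v p = 0 ∧ ∀ i, i ∉ A → v i = 0}
      add_mem' := by
        rintro a b ⟨ha, ha'⟩ ⟨hb, hb'⟩
        exact ⟨by simp [ha, hb], fun i hi => by simp [ha' i hi, hb' i hi]⟩
      zero_mem' := ⟨rfl, fun _ _ => rfl⟩
      smul_mem' := by
        rintro c a ⟨ha, ha'⟩
        exact ⟨by simp [ha], fun i hi => by simp [ha' i hi]⟩ }
  let f : (Fin n → ℝ) →ₗ[ℝ] EuclideanSpace ℝ κ :=
    (WithLp.linearEquiv 2 ℝ (κ → ℝ)).symm.toLinearMap ∘ₗ B.mulVecLin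
  have hf : ∀ u, eNorm (B.mulVec u) = ‖f u‖ := fun u => rfl
  let K := V.map f
  obtain ⟨w, hw, hmin⟩ := K.exists_norm_eq_iInf_of_complete_subspace
    (FiniteDimensional.complete ℝ K |> completeSpace_coe_iff_isComplete.mp)
    (f (Pi.single p 1))
  obtain ⟨w', hw', rfl⟩ := hw
  refine ⟨Pi.single p 1 - w', ⟨?_, ?_⟩, ?_⟩
  · simp [hw'.1]
  · intro i hi
    have : i ≠ p := fun h => hi (h ▸ hp)
    simp [this, hw'.2 i hi]
  · intro v hv
    have hvV : Pi.single p 1 - v ∈ V := by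
      refine ⟨by simp [hv.1], fun i hi => ?_⟩
      have : i ≠ p := fun h => hi (h ▸ hp)
      simp [this, hv.2 i hi]
    have hb : BddBelow (Set.range fun w : (K : Set (EuclideanSpace ℝ κ)) =>
        ‖f (Pi.single p 1) - w‖) := ⟨0, by rintro _ ⟨w, rfl⟩; positivity⟩
    have h := ciInf_le hb ⟨f (Pi.single p 1 - v), Submodule.mem_map_of_mem hvV⟩
    rw [hf, hf, map_sub, hmin]
    refine h.trans (le_of_eq ?_)
    simp only [map_sub, sub_sub_cancel]

/-- The step direction: an admissible `u` that minimizes `‖B u‖`. -/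
def stepDirection {κ : Type*} [Fintype κ] (B : Matrix κ (Fin n) ℝ)
    {A : Finset (Fin n)} {p : Fin n} (hp : p ∈ A) : Fin n → ℝ :=
  (exists_stepDirection B hp).choose

/-- The step sizes that keep all fractional assignments in `[-1, 1]`. -/
def feasibleSteps (z u : Fin n → ℝ) : Set ℝ := {δ | ∀ i, z i + δ * u i ∈ Set.Icc (-1 : ℝ) 1}

/-- `δ⁺ = |max Δ|`. -/
def stepPlus (z u : Fin n → ℝ) : ℝ := |sSup (feasibleSteps z u)|

/-- `δ⁻ = |min Δ|`. -/
def stepMinus (z u : Fin n → ℝ) : ℝ := |sInf (feasibleSteps z u)|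

/-- The distribution on two points that takes the value `x` with probability `q` and the value `y`
with probability `1 - q`. -/
def twoPoint {α : Type*} (q : ℝ) (h0 : 0 ≤ q) (h1 : q ≤ 1) (x y : α) : PMF α :=
  (PMF.ofFintype (fun b : Bool => ENNReal.ofReal (if b then q else 1 - q)) (by
    rw [Fintype.sum_bool, ← ENNReal.ofReal_add] <;> simp [h0, h1])).map
    fun b => if b then x else y

/-- The random step size: `δ⁺` with probability `δ⁻ / (δ⁺ + δ⁻)`, and otherwise, that is with
probability `δ⁺ / (δ⁺ + δ⁻)`, `-δ⁻`. -/
def stepSize (z u : Fin n → ℝ) : PMF ℝ :=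
  twoPoint (stepMinus z u / (stepPlus z u + stepMinus z u))
    (div_nonneg (abs_nonneg _) (add_nonneg (abs_nonneg _) (abs_nonneg _)))
    (div_le_one_of_le₀ (le_add_of_nonneg_left (abs_nonneg _))
      (add_nonneg (abs_nonneg _) (abs_nonneg _)))
    (stepPlus z u) (-stepMinus z u)

/-- The current pivot: the previous pivot for as long as it is alive, otherwise (also when there is
no previous pivot) a unit drawn uniformly at random from the alive units. -/
def pivot (A : Finset (Fin n)) (hA : A.Nonempty) (prev : Option (Fin n)) :
    PMF {i // i ∈ A} :=
  match prev with
  | none => PMF.uniformOfFinset A.attach (Finset.attach_nonempty_iff.mpr hA)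
  | some p =>
    if hp : p ∈ A then PMF.pure ⟨p, hp⟩
    else PMF.uniformOfFinset A.attach (Finset.attach_nonempty_iff.mpr hA)

/-- The state of the algorithm: the fractional assignments and the most recent pivot, if any. -/
abbrev State (n : ℕ) : Type := (Fin n → ℝ) × Option (Fin n)

/-- One iteration of the algorithm with input matrix `B`. The algorithm stops, that is, the state
no longer changes, once all assignments are integral. -/
def iteration {κ : Type*} [Fintype κ] (B : Matrix κ (Fin n) ℝ) (s : State n) : PMF (State n) :=
  if hA : (alive s.1).Nonempty then
    (pivot (alive s.1) hA s.2).bind fun p =>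
      (stepSize s.1 (stepDirection B p.2)).map fun δ =>
        (s.1 + δ • stepDirection B p.2, some p.1)
  else PMF.pure s

/-- The distribution of the state after `t` iterations, started from the fractional assignments
`(0, …, 0)`. -/
def stateAfter {κ : Type*} [Fintype κ] (B : Matrix κ (Fin n) ℝ) : ℕ → PMF (State n)
  | 0 => PMF.pure (0, none)
  | t + 1 => (stateAfter B t).bind (iteration B)

/-- The Gram–Schmidt Walk design with covariates `X` and design parameter `φ`: the distribution of
the assignment vector on which the algorithm, run on the augmented covariates, stops. It stops
after at most `n` iterations, see `gswDesign_support`. -/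
def gswDesign (X : Matrix (Fin n) (Fin d) ℝ) (φ : ℝ) : PMF (Fin n → ℝ) :=
  (stateAfter (augmented X φ) n).map Prod.fst

theorem stepDirection_spec {κ : Type*} [Fintype κ] (B : Matrix κ (Fin n) ℝ)
    {A : Finset (Fin n)} {p : Fin n} (hp : p ∈ A) :
    IsAdmissible A p (stepDirection B hp) ∧
      ∀ v, IsAdmissible A p v → eNorm (B.mulVec (stepDirection B hp)) ≤ eNorm (B.mulVec v) :=
  (exists_stepDirection B hp).choose_spec

theorem mem_alive {z : Fin n → ℝ} {i : Fin n} : i ∈ alive z ↔ |z i| < 1 := by simp [alive]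

theorem feasibleSteps_facts {z u : Fin n → ℝ} {p : Fin n} (hz : ∀ i, |z i| ≤ 1)
    (hu : IsAdmissible (alive z) p u) :
    IsCompact (feasibleSteps z u) ∧ (0 : ℝ) ∈ feasibleSteps z u ∧
      ∀ δ ∈ feasibleSteps z u, (∀ i ∈ alive z, |z i + δ * u i| < 1) →
        δ ∈ interior (feasibleSteps z u) := by
  have h0 : (0 : ℝ) ∈ feasibleSteps z u := fun i => by
    simpa [abs_le] using hz i
  refine ⟨?_, h0, ?_⟩
  · refine Metric.isCompact_of_isClosed_isBounded ?_ ?_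
    · have : feasibleSteps z u = ⋂ i, (fun δ => z i + δ * u i) ⁻¹' Set.Icc (-1 : ℝ) 1 := by
        ext; simp [feasibleSteps]
      rw [this]
      exact isClosed_iInter fun i => isClosed_Icc.preimage (by fun_prop)
    · refine (Metric.isBounded_Icc (-2 : ℝ) 2).subset fun δ hδ => ?_
      have h := hδ p
      have h' := abs_le.mp (hz p)
      rw [hu.1, Set.mem_Icc] at h
      constructor <;> linarith [h.1, h.2]
  · intro δ hδ hlt
    rw [mem_interior_iff_mem_nhds]
    have : ∀ i, ∀ᶠ ε in nhds δ, z i + ε * u i ∈ Set.Icc (-1 : ℝ) 1 := by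
      intro i
      by_cases hi : i ∈ alive z
      · have hc : Continuous fun ε : ℝ => |z i + ε * u i| := by fun_prop
        filter_upwards [hc.continuousAt.eventually_lt continuousAt_const (hlt i hi)] with ε hε
        exact abs_le.mp hε.le
      · refine Filter.Eventually.of_forall fun ε => ?_
        simpa [hu.2 i hi, abs_le] using hz i
    filter_upwards [Filter.eventually_all.mpr this] with ε hε using hε

theorem not_mem_interior_of_isGreatest {S : Set ℝ} {x : ℝ} (h : IsGreatest S x) :
    x ∉ interior S := by
  intro hx
  obtain ⟨ε, hε, hb⟩ := Metric.isOpen_iff.mp isOpen_interior x hx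
  have hm : x + ε / 2 ∈ S := interior_subset (hb (by
    rw [Metric.mem_ball, Real.dist_eq, add_sub_cancel_left, abs_of_pos (by positivity)]; linarith))
  linarith [h.2 hm]

theorem not_mem_interior_of_isLeast {S : Set ℝ} {x : ℝ} (h : IsLeast S x) :
    x ∉ interior S := by
  intro hx
  obtain ⟨ε, hε, hb⟩ := Metric.isOpen_iff.mp isOpen_interior x hx
  have hm : x - ε / 2 ∈ S := interior_subset (hb (by
    rw [Metric.mem_ball, Real.dist_eq, abs_sub_comm, sub_sub_cancel, abs_of_pos (by positivity)]
    linarith))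
  linarith [h.2 hm]

/-- An iteration keeps the assignments in `[-1, 1]` and makes at least one more of them integral. -/
theorem step_facts {z u : Fin n → ℝ} {p : Fin n} (hz : ∀ i, |z i| ≤ 1)
    (hu : IsAdmissible (alive z) p u) {δ : ℝ} (hδ : δ ∈ (stepSize z u).support) :
    (∀ i, |(z + δ • u) i| ≤ 1) ∧ alive (z + δ • u) ⊂ alive z := by
  obtain ⟨hc, h0, hint⟩ := feasibleSteps_facts hz hu
  have hG := hc.isGreatest_sSup ⟨0, h0⟩
  have hL := hc.isLeast_sInf ⟨0, h0⟩
  have hδ' : δ = sSup (feasibleSteps z u) ∨ δ = sInf (feasibleSteps z u) := by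
    rw [stepSize, twoPoint, PMF.support_map] at hδ
    obtain ⟨b, -, rfl⟩ := hδ
    cases b
    · right
      simp [stepMinus, abs_of_nonpos (hL.2 h0)]
    · left
      simp [stepPlus, abs_of_nonneg (hG.2 h0)]
  have hmem : δ ∈ feasibleSteps z u := by
    rcases hδ' with h | h
    · exact h ▸ hG.1
    · exact h ▸ hL.1
  have hnint : δ ∉ interior (feasibleSteps z u) := by
    rcases hδ' with h | h
    · exact h ▸ not_mem_interior_of_isGreatest hG
    · exact h ▸ not_mem_interior_of_isLeast hL
  refine ⟨fun i => abs_le.mpr (hmem i), Finset.ssubset_iff_subset_ne.mpr ⟨fun i hi => ?_, fun h => ?_⟩⟩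
  · by_contra hi'
    apply hi'
    simpa [mem_alive, hu.2 i hi'] using hi
  · refine hnint (hint δ hmem fun i hi => ?_)
    rw [← h] at hi
    simpa [mem_alive] using hi

theorem stateAfter_facts {κ : Type*} [Fintype κ] (B : Matrix κ (Fin n) ℝ) (t : ℕ) {s : State n}
    (hs : s ∈ (stateAfter B t).support) :
    (∀ i, |s.1 i| ≤ 1) ∧ (alive s.1).card ≤ n - t := by
  induction t generalizing s with
  | zero =>
    rw [stateAfter, PMF.support_pure, Set.mem_singleton_iff] at hs
    subst hs
    exact ⟨fun i => by simp, (Finset.card_le_univ _).trans (by simp)⟩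
  | succ t ih =>
    rw [stateAfter, PMF.mem_support_bind_iff] at hs
    obtain ⟨s', hs', h⟩ := hs
    obtain ⟨h1, h2⟩ := ih hs'
    rw [iteration] at h
    split_ifs at h with hA
    · rw [PMF.mem_support_bind_iff] at h
      obtain ⟨p, -, h⟩ := h
      rw [PMF.support_map] at h
      obtain ⟨δ, hδ, rfl⟩ := h
      obtain ⟨h3, h4⟩ := step_facts h1 (stepDirection_spec B p.2).1 hδ
      have h5 := Finset.card_lt_card h4
      exact ⟨h3, show (alive (s'.1 + δ • stepDirection B p.2)).card ≤ n - (t + 1) by omega⟩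
    · rw [PMF.support_pure, Set.mem_singleton_iff] at h
      subst h
      rw [Finset.not_nonempty_iff_eq_empty] at hA
      exact ⟨h1, by simp [hA]⟩

/-- The design assigns every unit to one of the two treatments. -/
theorem gswDesign_support (X : Matrix (Fin n) (Fin d) ℝ) (φ : ℝ) {z : Fin n → ℝ}
    (hz : z ∈ (gswDesign X φ).support) (i : Fin n) : z i = 1 ∨ z i = -1 := by
  rw [gswDesign, PMF.support_map] at hz
  obtain ⟨s, hs, rfl⟩ := hz
  obtain ⟨h1, h2⟩ := stateAfter_facts _ _ hs
  have h3 : i ∉ alive s.1 := by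
    rw [Nat.sub_self, Nat.le_zero, Finset.card_eq_zero] at h2
    simp [h2]
  rw [mem_alive, not_lt] at h3
  exact eq_or_eq_neg_of_abs_eq (le_antisymm (h1 i) h3)

/-- The average treatment effect `τ`, where `a` and `b` are the vectors of potential outcomes under
the treatments `1` and `-1`. -/
def ate (a b : Fin n → ℝ) : ℝ := (1 / n) * ∑ i, (a i - b i)

/-- The observed outcome of unit `i` under the assignments `z`. -/
def observed (a b : Fin n → ℝ) (z : Fin n → ℝ) (i : Fin n) : ℝ := if z i = 1 then a i else b i

/-- The Horvitz–Thompson estimator of the average treatment effect under the design `P`. -/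
def horvitzThompson (P : PMF (Fin n → ℝ)) (a b : Fin n → ℝ) (z : Fin n → ℝ) : ℝ :=
  (1 / n) * (∑ i with z i = 1, observed a b z i / P.toMeasure.real {w | w i = 1} -
    ∑ i with z i = -1, observed a b z i / P.toMeasure.real {w | w i = -1})

/-- The mean squared error of the Horvitz–Thompson estimator under the design `P`. -/
def meanSquaredError (P : PMF (Fin n → ℝ)) (a b : Fin n → ℝ) : ℝ :=
  ∫ z, (horvitzThompson P a b z - ate a b) ^ 2 ∂P.toMeasure

/-- The loss function of the ridge regression of `μ` on the covariates. -/
def ridgeLoss (X : Matrix (Fin n) (Fin d) ℝ) (φ : ℝ) (μ : Fin n → ℝ) (β : Fin d → ℝ) : ℝ :=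
  1 / φ * eNorm (μ - X.mulVec β) ^ 2 + maxRowNorm X ^ 2 / (1 - φ) * eNorm β ^ 2

end GramSchmidtWalk

end

/-! Each unit gets either treatment with probability 1/2, so the error of the estimator is `2/n`
times `⟨z, μ⟩` (`horvitzThompson_sub_ate`). Every `β` yields a vector `v` with `Bᵀ v = μ` whose
squared length is the ridge loss at `β` (`inner_ridgeVector`, `norm_ridgeVector_sq`). It therefore
suffices that `E ⟨B z, v⟩² ≤ ‖v‖²` for all `v` (`expect_sq_inner_stateAfter_le`).

That bound comes from a supermartingale, `potential`. Let `P(A)` be the squared length of the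
projection of `v` onto the span of the columns in `A`. With alive set `A` and pivot `p`, the
potential adds to `⟨B z, v⟩²` the budget `(1 - z_p²) P(A) + z_p² P(A \ p)`. Since `u_p = 1`, a step
`δ` moves `z_p` by `δ`, and before `A` is updated the coefficient of `δ²` is `⟨B u, v⟩² - (P(A) -
P(A \ p))`. It is nonpositive because `B u` lies in the span of `A`, is orthogonal to the columns of
`A \ p`, and has length at most one. Terms linear in `δ` average to zero, and shrinking `A` only
lowers `P`. A pivot is replaced only once dead; then the budget is just `P(A)`, which no choice of
new pivot raises. The potential starts at most at `‖v‖²` and always dominates `⟨B z, v⟩²`. -/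

noncomputable section

namespace GramSchmidtWalk

variable {n d : ℕ}

/-! ### Expectations of nonnegative functions under a `PMF` -/

section Expectation

variable {α β : Type*}

/-- The expectation of a nonnegative function under a probability mass function. -/
def expect (P : PMF α) (f : α → ENNReal) : ENNReal := ∑' x, P x * f x

theorem expect_mono {P : PMF α} {f g : α → ENNReal} (h : ∀ x ∈ P.support, f x ≤ g x) :
    expect P f ≤ expect P g := by
  refine ENNReal.tsum_le_tsum fun x => ?_
  by_cases hx : P x = 0
  · simp [hx]
  · exact mul_le_mul_right (h x ((P.mem_support_iff x).2 hx)) _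

theorem expect_congr {P : PMF α} {f g : α → ENNReal} (h : ∀ x ∈ P.support, f x = g x) :
    expect P f = expect P g :=
  le_antisymm (expect_mono fun x hx => (h x hx).le) (expect_mono fun x hx => (h x hx).ge)

theorem expect_const (P : PMF α) (c : ENNReal) : expect P (fun _ => c) = c := by
  rw [expect, ENNReal.tsum_mul_right, P.tsum_coe, one_mul]

theorem expect_const_mul (P : PMF α) (c : ENNReal) (f : α → ENNReal) :
    expect P (fun x => c * f x) = c * expect P f := by
  rw [expect, expect, ← ENNReal.tsum_mul_left]
  exact tsum_congr fun x => mul_left_comm _ _ _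

theorem expect_bind (P : PMF α) (Q : α → PMF β) (f : β → ENNReal) :
    expect (P.bind Q) f = expect P fun a => expect (Q a) f := by
  simp only [expect, PMF.bind_apply, ← ENNReal.tsum_mul_right, ← ENNReal.tsum_mul_left]
  rw [ENNReal.tsum_comm]
  simp only [mul_assoc]

theorem expect_pure (a : α) (f : α → ENNReal) : expect (PMF.pure a) f = f a := by
  rw [expect, tsum_eq_single a]
  · simp
  · intro b hb
    simp [PMF.pure_apply, hb]

theorem expect_map (P : PMF α) (h : α → β) (f : β → ENNReal) :
    expect (P.map h) f = expect P (f ∘ h) := by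
  rw [← PMF.bind_pure_comp, expect_bind]
  simp only [Function.comp_apply, expect_pure]
  rfl

theorem expect_twoPoint (q : ℝ) (h0 : 0 ≤ q) (h1 : q ≤ 1) (x y : α) (f : α → ENNReal) :
    expect (twoPoint q h0 h1 x y) f = ENNReal.ofReal q * f x + ENNReal.ofReal (1 - q) * f y := by
  rw [twoPoint, expect_map, expect, tsum_bool, add_comm]
  simp

/-- The support of a `PMF` is countable, so the integral is a sum even over an uncountable type and
without measurability of `f`. -/
theorem lintegral_toMeasure [MeasurableSpace α] [MeasurableSingletonClass α] (P : PMF α)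
    (f : α → ENNReal) : ∫⁻ x, f x ∂P.toMeasure = expect P f := by
  rw [← P.restrict_toMeasure_support, lintegral_countable f P.support_countable, expect,
    ← tsum_subtype_eq_of_support_subset (s := P.support) (f := fun x => P x * f x)]
  · refine tsum_congr fun x => ?_
    rw [P.toMeasure_apply_singleton _ (measurableSet_singleton _), mul_comm]
  · intro x hx
    exact (P.mem_support_iff x).2 (left_ne_zero_of_mul hx)

theorem toMeasure_eq_expect [MeasurableSpace α] [MeasurableSingletonClass α] (P : PMF α)
    (s : Set α) : P.toMeasure s = expect P (s.indicator 1) := by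
  rw [P.toMeasure_apply_eq_tsum, expect]
  refine tsum_congr fun x => ?_
  by_cases hx : x ∈ s <;> simp [hx]

end Expectation

/-! ### Nonnegative supermartingales along the walk -/

/-- The random step size has mean zero. -/
theorem expect_stepSize (z u : Fin n → ℝ) {G C : ℝ}
    (h : ∀ δ ∈ (stepSize z u).support, 0 ≤ G + δ * C) :
    expect (stepSize z u) (fun δ => ENNReal.ofReal (G + δ * C)) = ENNReal.ofReal G := by
  set a := stepPlus z u with ha
  set b := stepMinus z u with hb
  have ha0 : 0 ≤ a := abs_nonneg _
  have hb0 : 0 ≤ b := abs_nonneg _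
  set q := b / (a + b) with hq
  have hq0 : 0 ≤ q := div_nonneg hb0 (add_nonneg ha0 hb0)
  have hq1 : q ≤ 1 := div_le_one_of_le₀ (le_add_of_nonneg_left ha0) (add_nonneg ha0 hb0)
  have hstep : stepSize z u = twoPoint q hq0 hq1 a (-b) := rfl
  have hmean : q * (a + b) = b := by
    -- If `a + b = 0`, both are zero and `q` is `0 / 0 = 0`.
    rcases eq_or_ne (a + b) 0 with h | h
    · rw [h]; linarith
    · rw [hq, div_mul_cancel₀ _ h]
  -- Nonnegativity is only known at outcomes of positive probability; an outcome of weight zero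
  -- contributes zero anyway.
  have hsupp : ∀ t, (0 < q ∧ t = a) ∨ (q < 1 ∧ t = -b) → t ∈ (stepSize z u).support := by
    intro t ht
    rw [hstep, twoPoint, PMF.support_map]
    rcases ht with ⟨h, rfl⟩ | ⟨h, rfl⟩
    · exact ⟨true, by simpa [PMF.mem_support_iff] using h, by simp⟩
    · exact ⟨false, by simpa [PMF.mem_support_iff] using h, by simp⟩
  have h1 : 0 ≤ q * (G + a * C) := by
    rcases hq0.eq_or_lt with h' | h'
    · simp [← h']
    · exact mul_nonneg hq0 (h _ (hsupp _ (Or.inl ⟨h', rfl⟩)))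
  have h2 : 0 ≤ (1 - q) * (G + -b * C) := by
    rcases hq1.eq_or_lt with h' | h'
    · simp [h']
    · exact mul_nonneg (sub_nonneg.2 hq1) (h _ (hsupp _ (Or.inr ⟨h', rfl⟩)))
  rw [hstep, expect_twoPoint, ← ENNReal.ofReal_mul hq0, ← ENNReal.ofReal_mul (sub_nonneg.2 hq1),
    ← ENNReal.ofReal_add h1 h2]
  congr 1
  linear_combination C * hmean

/-- The slope `C` may depend on the state and the pivot but not on `δ`; as `δ` has mean zero, the
linear term vanishes given the pivot. -/
theorem expect_iteration_le {κ : Type*} [Fintype κ] (B : Matrix κ (Fin n) ℝ) {g : State n → ℝ}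
    {s : State n} (hs : ∀ i, |s.1 i| ≤ 1) (hg : ∀ s : State n, (∀ i, |s.1 i| ≤ 1) → 0 ≤ g s)
    (h : ∀ (hA : (alive s.1).Nonempty), ∀ p ∈ (pivot (alive s.1) hA s.2).support, ∃ C : ℝ,
      ∀ δ ∈ (stepSize s.1 (stepDirection B p.2)).support,
        g (s.1 + δ • stepDirection B p.2, some p.1) ≤ g s + δ * C) :
    expect (iteration B s) (fun s => ENNReal.ofReal (g s)) ≤ ENNReal.ofReal (g s) := by
  rw [iteration]
  split_ifs with hA
  · rw [expect_bind]
    refine (expect_mono fun p hp => ?_).trans (expect_const _ _).le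
    obtain ⟨C, hC⟩ := h hA p hp
    rw [expect_map, ← expect_stepSize s.1 (stepDirection B p.2) (G := g s) (C := C)]
    · exact expect_mono fun δ hδ => ENNReal.ofReal_le_ofReal (hC δ hδ)
    · exact fun δ hδ =>
        (hg _ (step_facts hs (stepDirection_spec B p.2).1 hδ).1).trans (hC δ hδ)
  · rw [expect_pure]

theorem expect_stateAfter_le {κ : Type*} [Fintype κ] (B : Matrix κ (Fin n) ℝ) {g : State n → ℝ}
    (hg : ∀ s : State n, (∀ i, |s.1 i| ≤ 1) → 0 ≤ g s)
    (h : ∀ s : State n, (∀ i, |s.1 i| ≤ 1) →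
      ∀ (hA : (alive s.1).Nonempty), ∀ p ∈ (pivot (alive s.1) hA s.2).support, ∃ C : ℝ,
      ∀ δ ∈ (stepSize s.1 (stepDirection B p.2)).support,
        g (s.1 + δ • stepDirection B p.2, some p.1) ≤ g s + δ * C) (t : ℕ) :
    expect (stateAfter B t) (fun s => ENNReal.ofReal (g s)) ≤ ENNReal.ofReal (g (0, none)) := by
  induction t with
  | zero => rw [stateAfter, expect_pure]
  | succ t ih =>
    rw [stateAfter, expect_bind]
    refine le_trans (expect_mono fun s hs => ?_) ih
    have hs' := (stateAfter_facts B t hs).1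
    exact expect_iteration_le B hs' hg (h s hs')

/-! ### Assignment probabilities -/

/-- The indicator of the event is at most `(1 + c * w i) / 2` (truncated at zero), and this affine
function of the walk starts at 1/2 and has no drift. -/
theorem gswDesign_prob_le (X : Matrix (Fin n) (Fin d) ℝ) (φ : ℝ) (i : Fin n) {c : ℝ}
    (hc : |c| = 1) : (gswDesign X φ).toMeasure {w | w i = c} ≤ ENNReal.ofReal (1 / 2) := by
  have hcc : c * c = 1 := by rw [← abs_mul_abs_self, hc, one_mul]
  have hE := expect_stateAfter_le (augmented X φ) (g := fun s => 1 / 2 * (1 + c * s.1 i))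
    (fun s hs => by
      have : |c * s.1 i| ≤ 1 := by rw [abs_mul, hc, one_mul]; exact hs i
      linarith [(abs_le.1 this).1])
    (fun s _ _ p _ => ⟨1 / 2 * (c * stepDirection (augmented X φ) p.2 i), fun δ _ => le_of_eq (by
      simp only [Pi.add_apply, Pi.smul_apply, smul_eq_mul]; ring)⟩) n
  rw [toMeasure_eq_expect]
  calc expect (gswDesign X φ) ({w | w i = c}.indicator 1)
      ≤ expect (gswDesign X φ) (fun w => ENNReal.ofReal (1 / 2 * (1 + c * w i))) := by
        refine expect_mono fun w _ => ?_
        by_cases hw : w i = c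
        · simp [hw, hcc, one_add_one_eq_two]
        · simp [hw]
    _ ≤ _ := by
        rw [gswDesign, expect_map]
        exact hE.trans (by simp)

/-- The two events exhaust the support, so both upper bounds of 1/2 are attained. -/
theorem gswDesign_prob (X : Matrix (Fin n) (Fin d) ℝ) (φ : ℝ) (i : Fin n) :
    (gswDesign X φ).toMeasure.real {w | w i = 1} = 1 / 2 ∧
      (gswDesign X φ).toMeasure.real {w | w i = -1} = 1 / 2 := by
  have h1 : (gswDesign X φ).toMeasure.real {w | w i = 1} ≤ 1 / 2 :=
    ENNReal.toReal_le_of_le_ofReal (by norm_num) (gswDesign_prob_le X φ i (by simp))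
  have h2 : (gswDesign X φ).toMeasure.real {w | w i = -1} ≤ 1 / 2 :=
    ENNReal.toReal_le_of_le_ofReal (by norm_num) (gswDesign_prob_le X φ i (by simp))
  have hm : MeasurableSet {w : Fin n → ℝ | w i = 1 ∨ w i = -1} :=
    ((measurableSet_singleton (1 : ℝ)).union (measurableSet_singleton (-1))).preimage
      (measurable_pi_apply i)
  have h3 : (gswDesign X φ).toMeasure.real {w | w i = 1 ∨ w i = -1} = 1 := by
    rw [Measure.real, ((gswDesign X φ).toMeasure_apply_eq_one_iff hm).2
      fun w hw => gswDesign_support X φ hw i, ENNReal.toReal_one]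
  have h4 := measureReal_union_le (μ := (gswDesign X φ).toMeasure) {w | w i = 1} {w | w i = -1}
  rw [show {w : Fin n → ℝ | w i = 1} ∪ {w | w i = -1} = {w | w i = 1 ∨ w i = -1} from rfl, h3] at h4
  constructor <;> linarith

/-! ### The covariance bound -/

/-- Multiplication by `B`, with values in Euclidean space. -/
def mulVecEuclidean {κ : Type*} [Fintype κ] (B : Matrix κ (Fin n) ℝ) :
    (Fin n → ℝ) →ₗ[ℝ] EuclideanSpace ℝ κ :=
  (WithLp.linearEquiv 2 ℝ (κ → ℝ)).symm.toLinearMap ∘ₗ B.mulVecLin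

/-- The vectors whose coordinates outside `A` vanish. -/
def supportedOn (A : Finset (Fin n)) : Submodule ℝ (Fin n → ℝ) where
  carrier := {v | ∀ i, i ∉ A → v i = 0}
  add_mem' ha hb i hi := by simp [ha i hi, hb i hi]
  zero_mem' _ _ := rfl
  smul_mem' c a ha i hi := by simp [ha i hi]

/-- The span of the columns of `B` indexed by `A`. -/
def columnSpan {κ : Type*} [Fintype κ] (B : Matrix κ (Fin n) ℝ) (A : Finset (Fin n)) :
    Submodule ℝ (EuclideanSpace ℝ κ) := (supportedOn A).map (mulVecEuclidean B)

theorem columnSpan_mono {κ : Type*} [Fintype κ] (B : Matrix κ (Fin n) ℝ) {A A' : Finset (Fin n)}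
    (h : A ⊆ A') : columnSpan B A ≤ columnSpan B A' :=
  Submodule.map_mono fun _ hv i hi => hv i fun hi' => hi (h hi')

/-- The squared length of the projection of `v` onto the columns of `B` indexed by `A`. -/
def projSq {κ : Type*} [Fintype κ] (B : Matrix κ (Fin n) ℝ) (v : EuclideanSpace ℝ κ)
    (A : Finset (Fin n)) : ℝ := ‖(columnSpan B A).starProjection v‖ ^ 2

/-- Only the difference of the two projections of `v` pairs with `w`. Cauchy–Schwarz and Pythagoras
finish. -/
theorem sq_inner_le_sub_norm_starProjection_sq {E : Type*} [NormedAddCommGroup E]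
    [InnerProductSpace ℝ E] {K K' : Submodule ℝ E} [K.HasOrthogonalProjection]
    [K'.HasOrthogonalProjection] (hK : K' ≤ K) {w : E} (hw : w ∈ K) (hw1 : ‖w‖ ≤ 1)
    (hw' : ∀ x ∈ K', inner ℝ w x = 0) (v : E) :
    inner ℝ w v ^ 2 ≤ ‖K.starProjection v‖ ^ 2 - ‖K'.starProjection v‖ ^ 2 := by
  set x := K.starProjection v
  set y := K'.starProjection v
  have hy : y ∈ K' := K'.starProjection_apply_mem v
  have h1 : inner ℝ (v - x) w = 0 := K.starProjection_inner_eq_zero v w hw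
  have h2 : inner ℝ (v - x) y = 0 := K.starProjection_inner_eq_zero v y (hK hy)
  have h3 : inner ℝ (v - y) y = 0 := K'.starProjection_inner_eq_zero v y hy
  have h4 := hw' y hy
  rw [inner_sub_left] at h1 h2 h3
  have h5 : inner ℝ w v = inner ℝ w (x - y) := by
    rw [inner_sub_right, h4, real_inner_comm v w, real_inner_comm x w]; linarith
  have h6 : ‖x - y‖ ^ 2 = ‖x‖ ^ 2 - ‖y‖ ^ 2 := by
    rw [norm_sub_sq_real, ← real_inner_self_eq_norm_sq y]; linarith
  rw [h5, ← h6]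
  have h7 : |inner ℝ w (x - y)| ≤ ‖x - y‖ :=
    (abs_real_inner_le_norm _ _).trans (mul_le_of_le_one_left (norm_nonneg _) hw1)
  exact sq_le_sq' (abs_le.1 h7).1 (abs_le.1 h7).2

theorem inner_eq_zero_of_forall_norm_le {E : Type*} [NormedAddCommGroup E]
    [InnerProductSpace ℝ E] {w x : E} (h : ∀ t : ℝ, ‖w‖ ≤ ‖w + t • x‖) : inner ℝ w x = 0 := by
  set c := inner ℝ w x with hc
  have hpos : 0 < ‖x‖ ^ 2 + 1 := by positivity
  -- The `+ 1` in the near-optimal `t` spares the case `x = 0`.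
  have h1 := pow_le_pow_left₀ (norm_nonneg _) (h (-c / (‖x‖ ^ 2 + 1))) 2
  rw [norm_add_sq_real, inner_smul_right, norm_smul, mul_pow, Real.norm_eq_abs, sq_abs, ← hc] at h1
  have h2 : 2 * (-c / (‖x‖ ^ 2 + 1) * c) + (-c / (‖x‖ ^ 2 + 1)) ^ 2 * ‖x‖ ^ 2
      = -(c ^ 2 * (‖x‖ ^ 2 + 2)) / (‖x‖ ^ 2 + 1) ^ 2 := by
    field_simp; ring
  have h3 : 0 ≤ -(c ^ 2 * (‖x‖ ^ 2 + 2)) / (‖x‖ ^ 2 + 1) ^ 2 := by rw [← h2]; linarith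
  rw [le_div_iff₀ (by positivity), zero_mul] at h3
  have h4 : c ^ 2 ≤ 0 := by nlinarith [sq_nonneg c, sq_nonneg ‖x‖, mul_nonneg (sq_nonneg c) (sq_nonneg ‖x‖)]
  exact pow_eq_zero_iff two_ne_zero |>.1 (le_antisymm h4 (sq_nonneg c))

theorem projSq_mono {κ : Type*} [Fintype κ] (B : Matrix κ (Fin n) ℝ) (v : EuclideanSpace ℝ κ)
    {A A' : Finset (Fin n)} (h : A ⊆ A') : projSq B v A ≤ projSq B v A' := by
  have := sq_inner_le_sub_norm_starProjection_sq (columnSpan_mono B h) (Submodule.zero_mem _)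
    (by simp) (by simp) v
  rw [inner_zero_left] at this
  simp only [projSq]
  linarith

/-- Minimality gives orthogonality to the columns of `A.erase p`, and comparison with `Pi.single p
1` bounds the length by that of column `p`. -/
theorem sq_inner_stepDirection_le {κ : Type*} [Fintype κ] (B : Matrix κ (Fin n) ℝ)
    (hB : ∀ i, ‖mulVecEuclidean B (Pi.single i 1)‖ ≤ 1) (v : EuclideanSpace ℝ κ)
    {A : Finset (Fin n)} {p : Fin n} (hp : p ∈ A) :
    inner ℝ (mulVecEuclidean B (stepDirection B hp)) v ^ 2 ≤
      projSq B v A - projSq B v (A.erase p) := by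
  obtain ⟨hu, hmin⟩ := stepDirection_spec B hp
  have hmin' : ∀ x, IsAdmissible A p x →
    ‖mulVecEuclidean B (stepDirection B hp)‖ ≤ ‖mulVecEuclidean B x‖ := hmin
  refine sq_inner_le_sub_norm_starProjection_sq (columnSpan_mono B (A.erase_subset p))
    (Submodule.mem_map_of_mem hu.2) ((hmin' (Pi.single p 1) ⟨by simp, fun i hi => ?_⟩).trans (hB p))
    ?_ v
  · have : i ≠ p := fun h => hi (h ▸ hp)
    simp [this]
  · rintro _ ⟨x, hx, rfl⟩
    refine inner_eq_zero_of_forall_norm_le fun t => ?_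
    rw [← map_smul, ← map_add]
    refine hmin' _ ⟨?_, fun i hi => ?_⟩
    · simp [hu.1, hx p (by simp)]
    · simp [hu.2 i hi, hx i fun h => hi (Finset.mem_of_mem_erase h)]

/-- A bound on the conditional second moment, given the current state, of the component of `B z`
in direction `v`, where `z` is the final assignment vector. -/
def potential {κ : Type*} [Fintype κ] (B : Matrix κ (Fin n) ℝ) (v : EuclideanSpace ℝ κ)
    (s : State n) : ℝ :=
  inner ℝ (mulVecEuclidean B s.1) v ^ 2 +
    match s.2 with
    | none => projSq B v (alive s.1)
    | some p => (1 - s.1 p ^ 2) * projSq B v (alive s.1) +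
        s.1 p ^ 2 * projSq B v ((alive s.1).erase p)

theorem sq_inner_le_potential {κ : Type*} [Fintype κ] (B : Matrix κ (Fin n) ℝ)
    (v : EuclideanSpace ℝ κ) {s : State n} (hs : ∀ i, |s.1 i| ≤ 1) :
    inner ℝ (mulVecEuclidean B s.1) v ^ 2 ≤ potential B v s := by
  obtain ⟨z, _ | p⟩ := s
  · exact le_add_of_nonneg_right (sq_nonneg _)
  · have : z p ^ 2 ≤ 1 := (sq_le_one_iff_abs_le_one _).2 (hs p)
    exact le_add_of_nonneg_right
      (add_nonneg (mul_nonneg (by linarith) (sq_nonneg _)) (mul_nonneg (sq_nonneg _) (sq_nonneg _)))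

theorem potential_some_le_of_mem_support_pivot {κ : Type*} [Fintype κ] (B : Matrix κ (Fin n) ℝ)
    (v : EuclideanSpace ℝ κ) {s : State n} (hs : ∀ i, |s.1 i| ≤ 1) {hA : (alive s.1).Nonempty}
    {p : {i // i ∈ alive s.1}} (hp : p ∈ (pivot (alive s.1) hA s.2).support) :
    potential B v (s.1, some p.1) ≤ potential B v s := by
  have key : potential B v (s.1, some p.1) ≤
      inner ℝ (mulVecEuclidean B s.1) v ^ 2 + projSq B v (alive s.1) := by
    have h1 := projSq_mono B v ((alive s.1).erase_subset p.1)
    have h2 := mul_le_mul_of_nonneg_left h1 (sq_nonneg (s.1 p.1))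
    simp only [potential]
    linarith
  obtain ⟨z, _ | r⟩ := s
  · exact key
  · by_cases hr : r ∈ alive z
    · have : p = ⟨r, hr⟩ := by simpa [pivot, hr] using hp
      rw [this]
    -- A dead pivot is not in the alive set, so both weighted terms carry the same projection.
    · refine key.trans (le_of_eq ?_)
      simp only [potential, Finset.erase_eq_of_notMem hr]
      ring

theorem potential_step_le {κ : Type*} [Fintype κ] (B : Matrix κ (Fin n) ℝ)
    (hB : ∀ i, ‖mulVecEuclidean B (Pi.single i 1)‖ ≤ 1) (v : EuclideanSpace ℝ κ)
    {z : Fin n → ℝ} (hz : ∀ i, |z i| ≤ 1) {p : Fin n} (hp : p ∈ alive z) :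
    ∃ C : ℝ, ∀ δ ∈ (stepSize z (stepDirection B hp)).support,
      potential B v (z + δ • stepDirection B hp, some p) ≤
        potential B v (z, some p) + δ * C := by
  set u := stepDirection B hp with hu
  have hadm : IsAdmissible (alive z) p u := (stepDirection_spec B hp).1
  have hD := sq_inner_stepDirection_le B hB v hp
  rw [← hu] at hD
  set D := projSq B v (alive z) - projSq B v ((alive z).erase p) with hDdef
  -- The coefficient of `δ` in the expansion of `⟨B (z + δ u), v⟩² - (z p + δ)² D`.
  refine ⟨2 * (inner ℝ (mulVecEuclidean B z) v * inner ℝ (mulVecEuclidean B u) v - z p * D),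
    fun δ hδ => ?_⟩
  obtain ⟨h1, h2⟩ := step_facts hz hadm hδ
  have hval : (z + δ • u) p = z p + δ := by simp [hadm.1]
  have hsq : (z p + δ) ^ 2 ≤ 1 := by
    rw [← hval]; exact (sq_le_one_iff_abs_le_one _).2 (h1 p)
  -- Both weights are nonnegative, so the projections for the new alive set may be replaced by those
  -- for the old one.
  have h3 := mul_le_mul_of_nonneg_left (projSq_mono B v h2.subset) (sub_nonneg.2 hsq)
  have h4 := mul_le_mul_of_nonneg_left (projSq_mono B v (Finset.erase_subset_erase p h2.subset))
    (sq_nonneg (z p + δ))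
  have h5 := mul_le_mul_of_nonneg_left hD (sq_nonneg δ)
  simp only [potential, hval, map_add, map_smul, inner_add_left, real_inner_smul_left]
  rw [hDdef] at h5 ⊢
  linarith

/-- The second moment of `B z` is at most the identity when the columns of `B` have length at
most one. -/
theorem expect_sq_inner_stateAfter_le {κ : Type*} [Fintype κ] (B : Matrix κ (Fin n) ℝ)
    (hB : ∀ i, ‖mulVecEuclidean B (Pi.single i 1)‖ ≤ 1) (v : EuclideanSpace ℝ κ) (t : ℕ) :
    expect (stateAfter B t) (fun s => ENNReal.ofReal (inner ℝ (mulVecEuclidean B s.1) v ^ 2)) ≤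
      ENNReal.ofReal (‖v‖ ^ 2) := by
  refine (expect_mono fun s hs => ENNReal.ofReal_le_ofReal
    (sq_inner_le_potential B v (stateAfter_facts B t hs).1)).trans
    ((expect_stateAfter_le B (g := potential B v) (fun s hs =>
      (sq_nonneg _).trans (sq_inner_le_potential B v hs)) (fun s hs hA p hp => ?_) t).trans
      (ENNReal.ofReal_le_ofReal ?_))
  · obtain ⟨C, hC⟩ := potential_step_le B hB v hs p.2
    exact ⟨C, fun δ hδ => (hC δ hδ).trans
      (add_le_add_left (potential_some_le_of_mem_support_pivot B v hs hp) _)⟩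
  · simp only [potential, map_zero, inner_zero_left, projSq]
    have := pow_le_pow_left₀ (norm_nonneg _)
      ((columnSpan B (alive 0)).norm_starProjection_apply_le v) 2
    simpa using this

/-! ### The augmented covariates and the ridge loss -/

theorem eNorm_sq {ι : Type*} [Fintype ι] (v : ι → ℝ) : eNorm v ^ 2 = ∑ i, v i ^ 2 := by
  simp [eNorm, EuclideanSpace.norm_sq_eq]

theorem eNorm_row_le_maxRowNorm (X : Matrix (Fin n) (Fin d) ℝ) (i : Fin n) :
    eNorm (X i) ≤ maxRowNorm X :=
  le_ciSup (f := fun i => eNorm (X i)) (Set.finite_range _).bddAbove i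

theorem eq_zero_of_maxRowNorm_eq_zero {X : Matrix (Fin n) (Fin d) ℝ} (h : maxRowNorm X = 0) :
    X = 0 := by
  ext i j
  have h1 : eNorm (X i) = 0 :=
    le_antisymm ((eNorm_row_le_maxRowNorm X i).trans h.le) (norm_nonneg _)
  have h2 := eNorm_sq (X i)
  rw [h1, zero_pow two_ne_zero, eq_comm,
    Finset.sum_eq_zero_iff_of_nonneg fun _ _ => sq_nonneg _] at h2
  simpa using h2 j (Finset.mem_univ j)

theorem norm_augmented_column_le (X : Matrix (Fin n) (Fin d) ℝ) {φ : ℝ} (hφ0 : 0 < φ)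
    (hφ1 : φ < 1) (i : Fin n) :
    ‖mulVecEuclidean (augmented X φ) (Pi.single i 1)‖ ≤ 1 := by
  have h1 : ‖mulVecEuclidean (augmented X φ) (Pi.single i 1)‖ ^ 2 =
      φ + ((maxRowNorm X)⁻¹ * eNorm (X i)) ^ 2 * (1 - φ) := by
    rw [show ‖mulVecEuclidean (augmented X φ) (Pi.single i 1)‖
      = eNorm ((augmented X φ).mulVec (Pi.single i 1)) from rfl, eNorm_sq, Fintype.sum_sum_type]
    simp only [Matrix.mulVec_single_one, augmented, Matrix.col_apply, Matrix.fromRows_apply_inl,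
      Matrix.fromRows_apply_inr, Matrix.smul_apply, Matrix.transpose_apply, smul_eq_mul, mul_pow,
      Real.sq_sqrt hφ0.le, Real.sq_sqrt (sub_nonneg.2 hφ1.le), eNorm_sq, ← Finset.mul_sum]
    rw [Finset.sum_eq_single i (fun j _ hj => by simp [hj]) (by simp)]
    simp only [Matrix.one_apply_eq]
    ring
  have h2 : (maxRowNorm X)⁻¹ * eNorm (X i) ≤ 1 := by
    have h0 : 0 ≤ maxRowNorm X := (norm_nonneg _).trans (eNorm_row_le_maxRowNorm X i)
    rw [inv_mul_eq_div]
    exact div_le_one_of_le₀ (eNorm_row_le_maxRowNorm X i) h0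
  have h3 : 0 ≤ (maxRowNorm X)⁻¹ * eNorm (X i) :=
    mul_nonneg (inv_nonneg.2 ((norm_nonneg _).trans (eNorm_row_le_maxRowNorm X i))) (norm_nonneg _)
  have h4 : ((maxRowNorm X)⁻¹ * eNorm (X i)) ^ 2 ≤ 1 := pow_le_one₀ h3 h2
  rw [← sq_le_one_iff₀ (norm_nonneg _), h1]
  nlinarith

/-- The preimage of `μ` under `augmented X φ` transposed that corresponds to the coefficients
`β`. -/
def ridgeVector (X : Matrix (Fin n) (Fin d) ℝ) (φ : ℝ) (μ : Fin n → ℝ) (β : Fin d → ℝ) :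
    EuclideanSpace ℝ (Fin n ⊕ Fin d) :=
  WithLp.toLp 2 (Sum.elim ((√φ)⁻¹ • (μ - X.mulVec β)) ((maxRowNorm X * (√(1 - φ))⁻¹) • β))

theorem norm_ridgeVector_sq (X : Matrix (Fin n) (Fin d) ℝ) {φ : ℝ} (hφ0 : 0 < φ)
    (hφ1 : φ < 1) (μ : Fin n → ℝ) (β : Fin d → ℝ) :
    ‖ridgeVector X φ μ β‖ ^ 2 = ridgeLoss X φ μ β := by
  rw [ridgeVector, ← eNorm, eNorm_sq, Fintype.sum_sum_type]
  simp only [Sum.elim_inl, Sum.elim_inr, Pi.smul_apply, smul_eq_mul, mul_pow, inv_pow,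
    Real.sq_sqrt hφ0.le, Real.sq_sqrt (sub_nonneg.2 hφ1.le), ← Finset.mul_sum, ridgeLoss, eNorm_sq]
  ring

theorem inner_ridgeVector (X : Matrix (Fin n) (Fin d) ℝ) {φ : ℝ} (hφ0 : 0 < φ)
    (hφ1 : φ < 1) (μ : Fin n → ℝ) (β : Fin d → ℝ) (z : Fin n → ℝ) :
    inner ℝ (mulVecEuclidean (augmented X φ) z) (ridgeVector X φ μ β) = ∑ i, z i * μ i := by
  have h1 : √φ ≠ 0 := (Real.sqrt_pos.2 hφ0).ne'
  have h2 : √(1 - φ) ≠ 0 := (Real.sqrt_pos.2 (sub_pos.2 hφ1)).ne'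
  have h3 : inner ℝ (mulVecEuclidean (augmented X φ) z) (ridgeVector X φ μ β) =
      (augmented X φ).mulVec z ⬝ᵥ
        Sum.elim ((√φ)⁻¹ • (μ - X.mulVec β)) ((maxRowNorm X * (√(1 - φ))⁻¹) • β) := by
    rw [EuclideanSpace.inner_eq_star_dotProduct, dotProduct_comm]
    rfl
  rw [h3, augmented, Matrix.fromRows_mulVec, sumElim_dotProduct_sumElim,
    Matrix.smul_mulVec, Matrix.one_mulVec, Matrix.smul_mulVec, Matrix.mulVec_transpose,
    smul_dotProduct, dotProduct_smul, smul_dotProduct, dotProduct_smul,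
    ← Matrix.dotProduct_mulVec, dotProduct_sub]
  simp only [smul_eq_mul]
  rw [← mul_assoc, mul_inv_cancel₀ h1, one_mul]
  change _ = z ⬝ᵥ μ
  -- For `ξ = 0` the factor `ξ⁻¹ ξ` is zero rather than one, but then `X = 0`.
  rcases eq_or_ne (maxRowNorm X) 0 with h | h
  · simp [eq_zero_of_maxRowNorm_eq_zero h]
  · field_simp
    ring

theorem exists_isLeast_ridgeLoss (X : Matrix (Fin n) (Fin d) ℝ) {φ : ℝ} (hφ0 : 0 < φ)
    (hφ1 : φ < 1) (μ : Fin n → ℝ) : ∃ L, IsLeast (Set.range (ridgeLoss X φ μ)) L := by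
  -- The ridge vector is affine in `β` and `f` is minus its linear part, so minimizing the loss is
  -- projecting onto the range of `f`.
  let f : (Fin d → ℝ) →ₗ[ℝ] EuclideanSpace ℝ (Fin n ⊕ Fin d) :=
    { toFun := fun β => ridgeVector X φ 0 0 - ridgeVector X φ 0 β
      map_add' := fun β γ => by
        ext (i | i) <;> simp [ridgeVector, Matrix.mulVec_add] <;> ring
      map_smul' := fun c β => by
        ext (i | i) <;> simp [ridgeVector, Matrix.mulVec_smul] <;> ring }
  have hf : ∀ β, ridgeVector X φ μ β = ridgeVector X φ μ 0 - f β := fun β => by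
    ext (i | i) <;> simp [ridgeVector, f]
    ring
  obtain ⟨β₀, hβ₀⟩ := Submodule.starProjection_apply_mem (LinearMap.range f)
    (ridgeVector X φ μ 0)
  refine ⟨_, ⟨β₀, rfl⟩, ?_⟩
  rintro _ ⟨β, rfl⟩
  rw [← norm_ridgeVector_sq X hφ0 hφ1, ← norm_ridgeVector_sq X hφ0 hφ1, hf β, hf β₀, hβ₀]
  refine pow_le_pow_left₀ (norm_nonneg _) ?_ 2
  rw [Submodule.starProjection_minimal]
  exact ciInf_le (f := fun x : LinearMap.range f => ‖ridgeVector X φ μ 0 - x‖)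
    ⟨0, by rintro _ ⟨x, rfl⟩; exact norm_nonneg _⟩ ⟨f β, LinearMap.mem_range_self f β⟩

/-! ### The error of the Horvitz–Thompson estimator -/

theorem horvitzThompson_sub_ate (X : Matrix (Fin n) (Fin d) ℝ) (φ : ℝ) (a b : Fin n → ℝ)
    {z : Fin n → ℝ} (hz : z ∈ (gswDesign X φ).support) :
    horvitzThompson (gswDesign X φ) a b z - ate a b =
      2 / n * ∑ i, z i * ((a i + b i) / 2) := by
  have h : (∑ i with z i = 1, observed a b z i /
        (gswDesign X φ).toMeasure.real {w | w i = 1}) -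
      (∑ i with z i = -1, observed a b z i / (gswDesign X φ).toMeasure.real {w | w i = -1}) -
      ∑ i, (a i - b i) = 2 * ∑ i, z i * ((a i + b i) / 2) := by
    rw [Finset.sum_filter, Finset.sum_filter, ← Finset.sum_sub_distrib, ← Finset.sum_sub_distrib,
      Finset.mul_sum]
    refine Finset.sum_congr rfl fun i _ => ?_
    rw [(gswDesign_prob X φ i).1, (gswDesign_prob X φ i).2]
    rcases gswDesign_support X φ hz i with h | h
    · simp only [h, observed, if_true]
      norm_num
      ring
    · simp only [h, observed, if_true]
      norm_num
      ring
  rw [horvitzThompson, ate, ← mul_sub, h]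
  ring

theorem meanSquaredError_gswDesign_le (X : Matrix (Fin n) (Fin d) ℝ) {φ : ℝ} (hφ0 : 0 < φ)
    (hφ1 : φ < 1) (a b : Fin n → ℝ) (β : Fin d → ℝ) :
    meanSquaredError (gswDesign X φ) a b ≤
      4 * ridgeLoss X φ (fun i => (a i + b i) / 2) β / (n : ℝ) ^ 2 := by
  set μ : Fin n → ℝ := fun i => (a i + b i) / 2
  have hL : 0 ≤ ridgeLoss X φ μ β := by
    rw [← norm_ridgeVector_sq X hφ0 hφ1]; exact sq_nonneg _
  -- Passing to the `ENNReal`-valued integral of the norm avoids any integrability argument.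
  refine (Real.le_norm_self _).trans ((norm_integral_le_lintegral_norm _).trans
    (ENNReal.toReal_le_of_le_ofReal (by positivity) ?_))
  rw [lintegral_toMeasure]
  calc expect (gswDesign X φ) (fun z => ENNReal.ofReal
          ‖(horvitzThompson (gswDesign X φ) a b z - ate a b) ^ 2‖)
      = expect (gswDesign X φ) (fun z => ENNReal.ofReal (4 / (n : ℝ) ^ 2) *
          ENNReal.ofReal (inner ℝ (mulVecEuclidean (augmented X φ) z)
            (ridgeVector X φ μ β) ^ 2)) := by
        refine expect_congr fun z hz => ?_
        rw [← ENNReal.ofReal_mul (by positivity), horvitzThompson_sub_ate X φ a b hz,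
          inner_ridgeVector X hφ0 hφ1, Real.norm_of_nonneg (sq_nonneg _)]
        congr 1
        ring
    _ ≤ ENNReal.ofReal (4 / (n : ℝ) ^ 2) * ENNReal.ofReal (‖ridgeVector X φ μ β‖ ^ 2) := by
        rw [expect_const_mul, gswDesign, expect_map]
        exact mul_le_mul_right (expect_sq_inner_stateAfter_le (augmented X φ)
          (norm_augmented_column_le X hφ0 hφ1) _ n) _
    _ = ENNReal.ofReal (4 * ridgeLoss X φ μ β / (n : ℝ) ^ 2) := by
        rw [← ENNReal.ofReal_mul (by positivity), norm_ridgeVector_sq X hφ0 hφ1]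
        congr 1
        ring

end GramSchmidtWalk

end

theorem mainTheorem2 {n d : ℕ} (hn : 0 < n) (X : Matrix (Fin n) (Fin d) ℝ)
    (φ : ℝ) (hφ0 : 0 < φ) (hφ1 : φ < 1) (a b : Fin n → ℝ) :
    ∃ L : ℝ,
      IsLeast (Set.range (GramSchmidtWalk.ridgeLoss X φ fun i => (a i + b i) / 2)) L ∧
      GramSchmidtWalk.meanSquaredError (GramSchmidtWalk.gswDesign X φ) a b ≤
        4 * L / (n : ℝ) ^ 2 := by
  obtain ⟨L, hL⟩ := GramSchmidtWalk.exists_isLeast_ridgeLoss X hφ0 hφ1 fun i => (a i + b i) / 2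
  obtain ⟨β, hβ⟩ := hL.1
  refine ⟨L, hL, ?_⟩
  rw [← hβ]
  exact GramSchmidtWalk.meanSquaredError_gswDesign_le X hφ0 hφ1 a b β
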